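/- **Setting.** Let $n, D\ge 1$ and $f\ge 0$ be integers with $3f<n$, and let $\varepsilon\in(0,1]$. There are $n$ asynchronous processes; an adaptive adversary schedules all events and may corrupt up to $f$ processes (making them Byzantine) at moments of its choice; a process that is never corrupted is *correct*. The processes use the following distributed objects, whose safety properties hold at every moment for the processes not corrupted so far, and whose liveness properties hold for the correct processes. * $\mathrm{AVSS}_j$ ($1\le j\le n$), verifiable secret sharing with leader $j$ for secrets in $[0..D-1]$. *Validity:* if a correct leader shares $x$, every correct process eventually receives SharingComplete, and only $x$ can be retrieved. *Totality:* if one correct process receives SharingComplete, all do. *Binding:* SharingComplete is received only after the leader has shared a secret; once some non-corrupted process receives it, the last secret shared so far is fixed, and only this secret can be retrieved. *Retrieve termination:* if sharing is complete and all correct processes invoke EnableRetrieve, then each Retrieve of a correct process returns. *Secrecy:* until a non-corrupted process invokes EnableRetrieve, the adversary's decisions do not depend on the secret of a non-corrupted leader; in particular, secrets shared by Byzantine leaders are chosen by the adversary from what it knows when it shares them. * Gather, which delivers to each process a set of ids $j$ for which the process accepts $j$, such that some set of at least $n-f$ ids is contained in all sets delivered to non-corrupted processes, and which terminates at all correct processes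 if they all start it, acceptance of a correct process that started eventually holds at all correct processes and is never withdrawn, and acceptance at one correct process implies eventual acceptance at all. * BAA, bundled approximate agreement on vectors in $\mathbb R^n$ with precision $\varepsilon/f$ (with $\varepsilon$ if $f=0$): each coordinate of an output lies in the range of that coordinate of the inputs of non-corrupted processes, outputs of non-corrupted processes differ by at most the precision in each coordinate, and every correct process obtains an output if all correct processes provide inputs. **Algorithm.** Every correct process $i$ invokes Toss: it draws $x_i$ uniformly from $[0..D-1]$, independently of everything else, shares $x_i$ through $\mathrm{AVSS}_i$, and starts Gather, accepting $j$ once it has received SharingComplete of $\mathrm{AVSS}_j$. When Gather delivers $S$, it runs BAA on the indicator vector of $S$. When BAA returns $(w'_1,\dots,w'_n)$, it invokes EnableRetrieve on all $\mathrm{AVSS}_j$, retrieves $x_j$ from $\mathrm{AVSS}_j$ for all $j$ with $w'_j\ne0$, puts $x_j=0$ for the other $j$, and returns $\left\lceil\sum_j x_jw'_j\right\rceil \bmod D$. **Theorem.** The algorithm implements an approximate common coin. For every (randomized, adaptive) adversary: 1. (*Termination*) In every execution, every correct process returns a value. 2. (*Approximate $\varepsilon$-consistency*) In every execution, if correct processes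 return $a$ and $b$, then $\min\{|a-b|,\,D-|a-b|\}\le\lceil\varepsilon D\rceil$. 3. (*One-process randomness*) In every execution some process returns from BAA while not corrupted. Let $i$ be the first one to do so, and let $R=\left\lceil\sum_j x_jw'_j\right\rceil\bmod D$ be computed from its BAA output $w'$ and the secrets held at that moment by the objects $\mathrm{AVSS}_j$ with $w'_j\neq 0$. If $i$ is correct (that is, is not corrupted later either), then it returns $R$ and nothing else. Moreover $R$ is uniformly distributed on $[0..D-1]$. If the above properties of the objects, the bound $f$ on corruptions and the participation of all correct processes are only guaranteed outside an event of probability at most $\eta\geq 0$, then 1, 2 and the first part of 3 hold outside this event, and $|\Pr[R\in B]-|B|/D|\le\eta$ for all $B\subseteq[0..D-1]$. -/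

import Mathlib

open MeasureTheory
open scoped NNReal ENNReal

noncomputable section

namespace ApproxCoin

/-! ### The algorithm run by every correct process, as a deterministic automaton -/

/-- Responses that a process receives from the distributed objects `AVSS_j`, `Gather`, `BAA`.
Secrets shared through AVSS are elements of the domain `[0..D-1]`. -/
inductive Response (n D : ℕ) where
  | sharingComplete (j : Fin n)
  | deliverSet (S : Finset (Fin n))
  | baaReturn (w : Fin n → ℝ)
  | retrieveReturn (j : Fin n) (v : Fin D)

/-- Inputs of the local automaton: the invocation of `Toss`, together with the outcome `r` of the
local random number generator, or a response of one of the distributed objects. -/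
inductive Input (n D : ℕ) where
  | toss (r : Fin D)
  | response (m : Response n D)

/-- Operations that a process invokes on the distributed objects; `shareSecret` is invoked by a
process on the AVSS instance of which it is the leader. -/
inductive Call (n D : ℕ) where
  | shareSecret (v : Fin D)
  | startGather
  | runBAA (u : Fin n → ℝ)
  | enableRetrieve (j : Fin n)
  | retrieve (j : Fin n)

/-- Control point: before `Toss`, waiting for Gather, waiting for BAA, or (with the weights
obtained from BAA) waiting for the secrets to be retrieved. -/
inductive Phase (n : ℕ) where
  | idle
  | gathering
  | agreeing
  | revealing (w : Fin n → ℝ)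

structure State (n D : ℕ) where
  phase : Phase n
  /-- the `j` for which `AVSS_j.SharingComplete()` was received -/
  completed : Finset (Fin n)
  retrieved : Fin n → Option (Fin D)

def State.init (n D : ℕ) : State n D := ⟨.idle, ∅, fun _ => none⟩

/-- The `0/1` vector of a set of process ids. -/
def initialWeights {n : ℕ} (S : Finset (Fin n)) : Fin n → ℝ := fun j => if j ∈ S then 1 else 0

/-- `⌈∑ j, x_j * w_j⌉ mod D`, where `x_j` is the given value if `w_j ≠ 0` and `0` otherwise. -/
def coinValue {n D : ℕ} (w : Fin n → ℝ) (y : Fin n → Option (Fin D)) : ℤ :=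
  ⌈∑ j, (if w j ≠ 0 then (y j).elim 0 (fun v => ((v : ℕ) : ℝ)) else 0) * w j⌉ % (D : ℤ)

/-- State change of the algorithm on an input. -/
def next {n D : ℕ} (s : State n D) : Input n D → State n D
  | .toss _ => match s.phase with
    | .idle => { s with phase := .gathering }
    | _ => s
  | .response (.sharingComplete j) => { s with completed := insert j s.completed }
  | .response (.deliverSet _) => match s.phase with
    | .gathering => { s with phase := .agreeing }
    | _ => s
  | .response (.baaReturn w) => match s.phase with
    | .agreeing => { s with phase := .revealing w }
    | _ => s
  | .response (.retrieveReturn j v) => match s.retrieved j with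
    | none => { s with retrieved := Function.update s.retrieved j (some v) }
    | some _ => s

/-- Operations invoked by the algorithm in reaction to an input. -/
def calls {n D : ℕ} (s : State n D) : Input n D → Set (Call n D)
  | .toss r => match s.phase with
    | .idle => {.shareSecret r, .startGather}
    | _ => ∅
  | .response (.deliverSet S) => match s.phase with
    | .gathering => {.runBAA (initialWeights S)}
    | _ => ∅
  | .response (.baaReturn w) => match s.phase with
    | .agreeing => {c | (∃ j, c = .enableRetrieve j) ∨ ∃ j, w j ≠ 0 ∧ c = .retrieve j}
    | _ => ∅
  | .response _ => ∅

open Classical in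
/-- The value returned by `Toss`, once every secret with a nonzero weight has been retrieved. -/
def output {n D : ℕ} (s : State n D) : Option ℤ :=
  match s.phase with
  | .revealing w =>
    if ∀ j, w j ≠ 0 → (s.retrieved j).isSome then some (coinValue w s.retrieved) else none
  | _ => none

/-! ### Histories and executions -/

/-- Events of the system. `corrupt i`: the adversary makes `i` Byzantine; `byzShare j v`: the
adversary invokes `AVSS_j.ShareSecret(v)` on behalf of a Byzantine `j` (no effect otherwise);
`toss i`: process `i` invokes `Toss`; `notify i m`: process `i` receives the response `m`. -/
inductive Action (n D : ℕ) where
  | skip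
  | corrupt (i : Fin n)
  | byzShare (j : Fin n) (v : Fin D)
  | toss (i : Fin n)
  | notify (i : Fin n) (m : Response n D)

/-- Finite histories, most recent event first. -/
abbrev History (n D : ℕ) := List (Action n D)

/-- What process `i` sees of an event; `x i` is the number drawn by process `i`. -/
def localInput {n D : ℕ} (x : Fin n → Fin D) (i : Fin n) : Action n D → Option (Input n D)
  | .toss k => if k = i then some (.toss (x i)) else none
  | .notify k m => if k = i then some (.response m) else none
  | _ => none

/-- Local state of the algorithm at process `i` after a history. -/
def state {n D : ℕ} (x : Fin n → Fin D) (i : Fin n) : History n D → State n D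
  | [] => .init n D
  | a :: h => match localInput x i a with
    | some m => next (state x i h) m
    | none => state x i h

/-- Process `i` invoked the operation `c` while it was not corrupted. -/
def Called {n D : ℕ} (x : Fin n → Fin D) (i : Fin n) (c : Call n D) : History n D → Prop
  | [] => False
  | a :: h => Called x i c h ∨
      (.corrupt i ∉ h ∧ ∃ m, localInput x i a = some m ∧ c ∈ calls (state x i h) m)

/-- Process `i` received the response `m` while it was not corrupted. -/
def Received {n D : ℕ} (i : Fin n) (m : Response n D) : History n D → Prop
  | [] => False
  | a :: h => Received i m h ∨ (.corrupt i ∉ h ∧ a = .notify i m)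

open Classical in
/-- The argument of `AVSS_j.ShareSecret`, if the event `a` after the history `h` is an invocation
of it by the leader `j` (by the algorithm if `j` is not corrupted, by the adversary if it is). -/
def shareArg {n D : ℕ} (x : Fin n → Fin D) (h : History n D) (j : Fin n) :
    Action n D → Option (Fin D)
  | .byzShare k v => if k = j ∧ .corrupt j ∈ h then some v else none
  | .toss k => if k = j ∧ .corrupt j ∉ h ∧ (state x j h).phase = .idle then some (x j) else none
  | _ => none

open Classical in
/-- The secret held by `AVSS_j`: the last one shared by the leader before `SharingComplete` was
first received by a non-corrupted process; from then on it is fixed. -/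
def secret {n D : ℕ} (x : Fin n → Fin D) (j : Fin n) : History n D → Option (Fin D)
  | [] => none
  | a :: h =>
    if ∃ i, Received i (.sharingComplete j) h then secret x j h
    else match shareArg x h j a with
      | some v => some v
      | none => secret x j h

/-- A correct process is one that is never corrupted in the execution. -/
def Correct {n D : ℕ} (H : ℕ → History n D) (i : Fin n) : Prop := ∀ t, .corrupt i ∉ H t

/-! ### The building blocks

Safety properties are required at every moment, with respect to the processes that are not
corrupted up to that moment; liveness properties concern the processes that are never corrupted. -/

/-- The instance of Asynchronous Verifiable Secret Sharing with leader `j`.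
(Secrecy is expressed by `knownSecrets` below.) -/
structure AVSSSpec {n D : ℕ} (x : Fin n → Fin D) (H : ℕ → History n D) (j : Fin n) : Prop where
  complete_shared : ∀ t i, .corrupt i ∉ H t → Received i (.sharingComplete j) (H t) →
    (secret x j (H t)).isSome
  retrieve_called : ∀ t i v, .corrupt i ∉ H t → H (t + 1) = .notify i (.retrieveReturn j v) :: H t →
    Called x i (.retrieve j) (H t)
  validity : Correct H j → ∀ t v, Called x j (.shareSecret v) (H t) →
    ∀ i, Correct H i → ∃ t', Received i (.sharingComplete j) (H t')
  validity_value : ∀ t v, .corrupt j ∉ H t → Called x j (.shareSecret v) (H t) →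
    ∀ i v', .corrupt i ∉ H t → Received i (.retrieveReturn j v') (H t) → v' = v
  totality : ∀ t i, Correct H i → Received i (.sharingComplete j) (H t) →
    ∀ k, Correct H k → ∃ t', Received k (.sharingComplete j) (H t')
  retrieve_termination :
    (∃ t i, Correct H i ∧ Received i (.sharingComplete j) (H t)) →
    (∀ i, Correct H i → ∃ t, Called x i (.enableRetrieve j) (H t)) →
    ∀ i, Correct H i → (∃ t, Called x i (.retrieve j) (H t)) →
      ∃ t v, Received i (.retrieveReturn j v) (H t)
  binding : ∀ t i, .corrupt i ∉ H t → Received i (.sharingComplete j) (H t) →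
    ∀ k v, .corrupt k ∉ H t → Received k (.retrieveReturn j v) (H t) → secret x j (H t) = some v

/-- `GatherAccept(j)` evaluated by process `i` after the history `h`. -/
def Accept {n D : ℕ} (x : Fin n → Fin D) (i j : Fin n) (h : History n D) : Prop :=
  j ∈ (state x i h).completed

def AcceptValidity {n D : ℕ} (x : Fin n → Fin D) (H : ℕ → History n D) : Prop :=
  (∀ i, Correct H i → (∃ t, Called x i .startGather (H t)) →
    ∀ k, Correct H k → ∃ t, Accept x k i (H t)) ∧
  ∀ i k, Correct H k → ∀ t t', t ≤ t' → Accept x k i (H t) → Accept x k i (H t')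

def AcceptTotality {n D : ℕ} (x : Fin n → Fin D) (H : ℕ → History n D) : Prop :=
  ∀ i k, Correct H k → (∃ t, Accept x k i (H t)) →
    ∀ l, Correct H l → ∃ t, Accept x l i (H t)

/-- Gather. The common core need not be fixed when the first set is delivered, which makes the
requirement weaker than that of a binding common core. -/
structure GatherSpec {n D : ℕ} (f : ℕ) (x : Fin n → Fin D) (H : ℕ → History n D) : Prop where
  deliver_once : ∀ t i S, .corrupt i ∉ H t → H (t + 1) = .notify i (.deliverSet S) :: H t →
    Called x i .startGather (H t) ∧ ∀ S', ¬ Received i (.deliverSet S') (H t)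
  accepted : ∀ t i S, .corrupt i ∉ H t → Received i (.deliverSet S) (H t) →
    ∀ j ∈ S, Accept x i j (H t)
  common_core : ∀ t, ∃ C : Finset (Fin n), n ≤ C.card + f ∧
    ∀ i, .corrupt i ∉ H t → ∀ S, Received i (.deliverSet S) (H t) → C ⊆ S
  termination : AcceptValidity x H → AcceptTotality x H →
    (∀ i, Correct H i → ∃ t, Called x i .startGather (H t)) →
    ∀ i, Correct H i → ∃ t S, Received i (.deliverSet S) (H t)

/-- Bundled Approximate Agreement with precision `δ`. -/
structure BAASpec {n D : ℕ} (δ : ℝ) (x : Fin n → Fin D) (H : ℕ → History n D) : Prop where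
  return_once : ∀ t i w, .corrupt i ∉ H t → H (t + 1) = .notify i (.baaReturn w) :: H t →
    (∃ u, Called x i (.runBAA u) (H t)) ∧ ∀ w', ¬ Received i (.baaReturn w') (H t)
  validity : ∀ t i w, .corrupt i ∉ H t → Received i (.baaReturn w) (H t) → ∀ j,
    (∃ k u, .corrupt k ∉ H t ∧ Called x k (.runBAA u) (H t) ∧ u j ≤ w j) ∧
    (∃ k u, .corrupt k ∉ H t ∧ Called x k (.runBAA u) (H t) ∧ w j ≤ u j)
  consistency : ∀ t i k w w', .corrupt i ∉ H t → .corrupt k ∉ H t →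
    Received i (.baaReturn w) (H t) → Received k (.baaReturn w') (H t) →
    ∀ j, |w j - w' j| ≤ δ
  termination : (∀ i, Correct H i → ∃ t u, Called x i (.runBAA u) (H t)) →
    ∀ i, Correct H i → ∃ t w, Received i (.baaReturn w) (H t)

/-- Executions of the algorithm: at most `f` processes get corrupted, every correct process invokes
`Toss`, and the distributed objects behave as specified. The precision of BAA is `ε / f`
(and `ε` if `f = 0`). -/
structure IsExecution {n D : ℕ} (f : ℕ) (ε : ℝ) (x : Fin n → Fin D) (H : ℕ → History n D) :
    Prop where
  corrupt_le : ∀ t, {i : Fin n | .corrupt i ∈ H t}.ncard ≤ f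
  participate : ∀ i, Correct H i → ∃ t, .toss i ∈ H t
  avss : ∀ j, AVSSSpec x H j
  gather : GatherSpec f x H
  baa : BAASpec (ε / (max f 1 : ℕ)) x H

/-! ### The adversary -/

open Classical in
/-- Local random numbers that the adversary knows after a history: the one of process `j` is
hidden unless `j` is corrupted or some non-corrupted process invoked `AVSS_j.EnableRetrieve()`. -/
def knownSecrets {n D : ℕ} (x : Fin n → Fin D) (h : History n D) : Fin n → Option (Fin D) :=
  fun j => if .corrupt j ∈ h ∨ ∃ i, Called x i (.enableRetrieve j) h then some (x j) else none

/-- An adaptive adversary chooses the next event from the whole history and the random numbers it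
knows. It thereby controls the schedule, the corruptions, the secrets shared by Byzantine processes
and everything that the specifications of the distributed objects leave open. -/
abbrev Adversary (n D : ℕ) := History n D → (Fin n → Option (Fin D)) → Action n D

/-- The history after `t` events. -/
def run {n D : ℕ} (A : Adversary n D) (x : Fin n → Fin D) : ℕ → History n D
  | 0 => []
  | t + 1 => A (run A x t) (knownSecrets x (run A x t)) :: run A x t

/-- The processes draw independent uniform numbers in `[0..D-1]`. -/
def localRandomness (n D : ℕ) [NeZero D] : Measure (Fin n → Fin D) :=
  Measure.pi fun _ => (PMF.uniformOfFintype (Fin D)).toMeasure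

/-! ### Approximate common coin -/

/-- `Toss` returns `v` at process `i`. -/
def Outputs {n D : ℕ} (x : Fin n → Fin D) (H : ℕ → History n D) (i : Fin n) (v : ℤ) : Prop :=
  ∃ t, output (state x i (H t)) = some v

/-- Distance in the ring of integers modulo `q`, for representatives in `[0..q-1]`. -/
def ringDist (q a b : ℤ) : ℤ := min |a - b| (q - |a - b|)

def Termination {n D : ℕ} (x : Fin n → Fin D) (H : ℕ → History n D) : Prop :=
  ∀ i, Correct H i → ∃ v, Outputs x H i v

def ApproxConsistency {n D : ℕ} (ε : ℝ) (x : Fin n → Fin D) (H : ℕ → History n D) : Prop :=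
  ∀ i k, Correct H i → Correct H k → ∀ a b, Outputs x H i a → Outputs x H k b →
    ringDist D a b ≤ ⌈ε * D⌉

/-- The last event of `h` is the return, with weights `w`, of the BAA invocation of the
non-corrupted process `i`, and no process returned from BAA earlier while not corrupted. -/
def FirstReturn {n D : ℕ} (h : History n D) (i : Fin n) (w : Fin n → ℝ) : Prop :=
  ∃ h', h = .notify i (.baaReturn w) :: h' ∧ .corrupt i ∉ h' ∧
    ∀ k u, ¬ Received k (.baaReturn u) h'

/-- `v` is the coin value of the process `i` that is the first to return from BAA, computed from
its weights and the secrets held by the AVSS instances at that moment. -/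
def FirstValue {n D : ℕ} (x : Fin n → Fin D) (H : ℕ → History n D) (i : Fin n) (v : ℤ) : Prop :=
  ∃ t w, FirstReturn (H t) i w ∧ v = coinValue w (fun j => secret x j (H t))

end ApproxCoin

end

/-! Consistency. Every BAA input of a non-corrupted process is the indicator of a set containing the
common core, so all resulting weights equal 1 on the core (`weight_eq_one`). Outside it there are at
most f ids; each contributes at most D times the BAA precision to the difference of two sums, hence
at most εD in total. Ceilings and reduction modulo D preserve the bound. Binding ensures that all
processes use the same secrets.

Randomness. The core has more than f ids, so when the first process returns from BAA some core
member j is not corrupted. Its weight is exactly 1, its secret is its own draw, and nobody has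
enabled retrieval yet (`exists_pivot`). Replacing x_j by x_j + c therefore leaves the run up to that
moment unchanged (`run_eq_of_pivot`) and adds c to the coin (`coinValue_update`). This rotation is
injective, so all coin values occur equally often.

The counting is done over the inputs satisfying `Fair`, not over those giving an execution: `Fair`
concerns a finite prefix of the run and is invariant under rotation, whereas being an execution also
concerns the future, which may depend on the revealed secret. Unfair inputs lie in the exceptional
event, which gives the error η after averaging over the adversary's randomness. -/

namespace ApproxCoin

variable {n D f : ℕ} {ε : ℝ} {x x' : Fin n → Fin D} {i j k : Fin n} {h : History n D}
  {H : ℕ → History n D} {t t' : ℕ}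

/-! ### Local computations -/

/-- The random numbers do not influence the local control state. -/
theorem state_congr (x x' : Fin n → Fin D) (i : Fin n) (h : History n D) :
    state x i h = state x' i h := by
  induction h with
  | nil => rfl
  | cons a h ih =>
    cases a with
    | toss k => by_cases hk : k = i <;> simp [state, localInput, hk, ih, next]
    | notify k m => by_cases hk : k = i <;> simp [state, localInput, hk, ih]
    | _ => simpa [state, localInput] using ih

theorem state_cons_of_ne {a : Action n D} (h1 : a ≠ .toss i) (h2 : ∀ m, a ≠ .notify i m) :
    state x i (a :: h) = state x i h := by
  cases a with
  | toss k =>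
    have hk : k ≠ i := fun e => h1 (e ▸ rfl)
    simp [state, localInput, hk]
  | notify k m =>
    have hk : k ≠ i := fun e => h2 m (e ▸ rfl)
    simp [state, localInput, hk]
  | _ => simp [state, localInput]

theorem state_toss : state x i (.toss i :: h) = next (state x i h) (.toss (x i)) := by
  simp [state, localInput]

theorem state_notify (m : Response n D) :
    state x i (.notify i m :: h) = next (state x i h) (.response m) := by
  simp [state, localInput]

/-- Case distinction on the effect of an event on process `i`. -/
theorem action_cases (i : Fin n) (a : Action n D) :
    a = .toss i ∨ (∃ m, a = .notify i m) ∨ (a ≠ .toss i ∧ ∀ m, a ≠ .notify i m) := by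
  by_cases h1 : a = .toss i
  · exact .inl h1
  · by_cases h2 : ∃ m, a = .notify i m
    · exact .inr (.inl h2)
    · exact .inr (.inr ⟨h1, fun m hm => h2 ⟨m, hm⟩⟩)

theorem localInput_eq_none {a : Action n D} (h1 : a ≠ .toss i) (h2 : ∀ m, a ≠ .notify i m) :
    localInput x i a = none := by
  cases a with
  | toss k =>
    have hk : k ≠ i := fun e => h1 (e ▸ rfl)
    simp [localInput, hk]
  | notify k m =>
    have hk : k ≠ i := fun e => h2 m (e ▸ rfl)
    simp [localInput, hk]
  | _ => rfl

theorem called_cons_of_ne {a : Action n D} {c : Call n D}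
    (h1 : a ≠ .toss i) (h2 : ∀ m, a ≠ .notify i m) :
    Called x i c (a :: h) ↔ Called x i c h := by
  simp [Called, localInput_eq_none h1 h2]

theorem called_toss {c : Call n D} :
    Called x i c (.toss i :: h) ↔
      Called x i c h ∨ (.corrupt i ∉ h ∧ c ∈ calls (state x i h) (.toss (x i))) := by
  simp [Called, localInput]

theorem called_notify {c : Call n D} {m : Response n D} :
    Called x i c (.notify i m :: h) ↔
      Called x i c h ∨ (.corrupt i ∉ h ∧ c ∈ calls (state x i h) (.response m)) := by
  simp [Called, localInput]

/-! ### What the operations invoked by a process tell about its state -/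

/-- This is what keeps draws hidden until the first return from BAA. -/
theorem Called.exists_baaReturn (hc : Called x i (.enableRetrieve j) h) :
    ∃ w, Received i (.baaReturn w) h := by
  induction h with
  | nil => exact hc.elim
  | cons a h ih =>
    rcases action_cases i a with rfl | ⟨m, rfl⟩ | ⟨h1, h2⟩
    · rcases called_toss.1 hc with hc | ⟨_, hc⟩
      · exact (ih hc).imp fun _ => .inl
      · rw [calls] at hc
        split at hc <;> simp at hc
    · rcases called_notify.1 hc with hc | ⟨hi, hc⟩
      · exact (ih hc).imp fun _ => .inl
      · cases m with
        | baaReturn w => exact ⟨w, .inr ⟨hi, rfl⟩⟩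
        | deliverSet S => rw [calls] at hc; split at hc <;> simp at hc
        | _ => simp [calls] at hc
    · exact (ih ((called_cons_of_ne h1 h2).1 hc)).imp fun _ => .inl

theorem Called.exists_deliverSet {u : Fin n → ℝ} (hc : Called x i (.runBAA u) h) :
    ∃ S, u = initialWeights S ∧ Received i (.deliverSet S) h := by
  induction h with
  | nil => exact hc.elim
  | cons a h ih =>
    rcases action_cases i a with rfl | ⟨m, rfl⟩ | ⟨h1, h2⟩
    · rcases called_toss.1 hc with hc | ⟨_, hc⟩
      · exact (ih hc).imp fun _ => .imp_right .inl
      · rw [calls] at hc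
        split at hc <;> simp at hc
    · rcases called_notify.1 hc with hc | ⟨hi, hc⟩
      · exact (ih hc).imp fun _ => .imp_right .inl
      · cases m with
        | baaReturn w => rw [calls] at hc; split at hc <;> simp at hc
        | deliverSet S =>
          rw [calls] at hc
          split at hc <;> simp at hc
          exact ⟨S, hc, .inr ⟨hi, rfl⟩⟩
        | _ => simp [calls] at hc
    · exact (ih ((called_cons_of_ne h1 h2).1 hc)).imp fun _ => .imp_right .inl

/-- Progress of the control point. -/
def Phase.rank : Phase n → ℕ
  | .idle => 0
  | .gathering => 1
  | .agreeing => 2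
  | .revealing _ => 3

theorem rank_le_rank_next (s : State n D) (m : Input n D) :
    s.phase.rank ≤ (next s m).phase.rank := by
  rcases s with ⟨p, c, r⟩
  cases m with
  | toss v => cases p <;> simp [next, Phase.rank]
  | response m =>
    cases m with
    | sharingComplete j => simp [next]
    | retrieveReturn j v => simp only [next]; split <;> simp
    | _ => cases p <;> simp [next, Phase.rank]

theorem rank_le_rank_cons (a : Action n D) :
    (state x i h).phase.rank ≤ (state x i (a :: h)).phase.rank := by
  rw [state]
  split
  · exact rank_le_rank_next _ _
  · exact le_rfl

/-- Together with the "not received before" clauses of Gather and BAA, this bound and the next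
determine the phase exactly when a response arrives. -/
theorem Called.one_le_rank (hc : Called x i .startGather h) : 1 ≤ (state x i h).phase.rank := by
  induction h with
  | nil => exact hc.elim
  | cons a h ih =>
    rcases hc with hc | ⟨_, m, hm, hc⟩
    · exact (ih hc).trans (rank_le_rank_cons a)
    · simp only [state, hm]
      generalize state x i h = s at *
      rcases s with ⟨p, c, r⟩
      cases m with
      | toss v => cases p <;> simp [next, Phase.rank, calls] at *
      | response m => cases m <;> cases p <;> simp [Phase.rank, calls] at *

theorem Called.two_le_rank {u : Fin n → ℝ} (hc : Called x i (.runBAA u) h) :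
    2 ≤ (state x i h).phase.rank := by
  induction h with
  | nil => exact hc.elim
  | cons a h ih =>
    rcases hc with hc | ⟨_, m, hm, hc⟩
    · exact (ih hc).trans (rank_le_rank_cons a)
    · simp only [state, hm]
      generalize state x i h = s at *
      rcases s with ⟨p, c, r⟩
      cases m with
      | toss v => cases p <;> simp [Phase.rank, calls] at *
      | response m => cases m <;> cases p <;> simp [next, Phase.rank, calls] at *

theorem one_le_rank_of_toss_mem (ht : .toss i ∈ h) : 1 ≤ (state x i h).phase.rank := by
  induction h with
  | nil => simp at ht
  | cons a h ih =>
    rcases List.mem_cons.1 ht with rfl | ht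
    · rw [state_toss]
      generalize state x i h = s
      rcases s with ⟨p, c, r⟩
      cases p <;> simp [next, Phase.rank]
    · exact (ih ht).trans (rank_le_rank_cons a)

/-! ### Responses leave a permanent trace in the local state. -/

theorem Received.mem_completed (hr : Received i (.sharingComplete j) h) :
    j ∈ (state x i h).completed := by
  induction h with
  | nil => exact hr.elim
  | cons a h ih =>
    rcases hr with hr | ⟨_, rfl⟩
    · have := ih hr
      rw [state]
      split
      · rename_i m _
        rcases m with v | m
        · simp only [next]; split <;> exact this
        · cases m with
          | sharingComplete l => exact Finset.mem_insert_of_mem this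
          | _ => simp only [next]; split <;> exact this
      · exact this
    · rw [state_notify]
      exact Finset.mem_insert_self _ _

theorem completed_subset_cons (a : Action n D) :
    (state x i h).completed ⊆ (state x i (a :: h)).completed := by
  rw [state]
  split
  · rename_i m _
    rcases m with v | m
    · simp only [next]; split <;> exact subset_rfl
    · cases m with
      | sharingComplete l => exact Finset.subset_insert _ _
      | _ => simp only [next]; split <;> exact subset_rfl
  · exact subset_rfl

theorem isSome_retrieved_cons (a : Action n D) (hs : ((state x i h).retrieved j).isSome) :
    ((state x i (a :: h)).retrieved j).isSome := by
  rw [state]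
  split
  · rename_i m _
    rcases m with v | m
    · simp only [next]; split <;> exact hs
    · cases m with
      | sharingComplete l => exact hs
      | retrieveReturn l v =>
        simp only [next]
        split
        · by_cases e : j = l
          · subst e; simp
          · simpa [Function.update_of_ne e] using hs
        · exact hs
      | _ => simp only [next]; split <;> exact hs
  · exact hs

theorem Received.isSome_retrieved {v : Fin D} (hr : Received i (.retrieveReturn j v) h) :
    ((state x i h).retrieved j).isSome := by
  induction h with
  | nil => exact hr.elim
  | cons a h ih =>
    rcases hr with hr | ⟨_, rfl⟩
    · exact isSome_retrieved_cons a (ih hr)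
    · rw [state_notify]
      simp only [next]
      split
      · simp
      · simp [*]

theorem phase_revealing_cons {w : Fin n → ℝ} (a : Action n D)
    (hs : (state x i h).phase = .revealing w) : (state x i (a :: h)).phase = .revealing w := by
  rw [state]
  split
  · rename_i m _
    generalize state x i h = s at *
    rcases s with ⟨p, c, r⟩
    obtain rfl : p = .revealing w := hs
    rcases m with v | m
    · rfl
    · cases m with
      | retrieveReturn l v => simp only [next]; split <;> rfl
      | _ => rfl
  · exact hs

/-! ### What the state of a non-corrupted process tells about its history -/

/-- Facts about the past of a process that can be read off its state. -/
structure PastOf (x : Fin n → Fin D) (i : Fin n) (h : History n D) : Prop where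
  completed : ∀ j ∈ (state x i h).completed, Received i (.sharingComplete j) h
  retrieved : ∀ j v, (state x i h).retrieved j = some v → Received i (.retrieveReturn j v) h
  started : 1 ≤ (state x i h).phase.rank →
    Called x i .startGather h ∧ ∃ v, Called x i (.shareSecret v) h
  delivered : 2 ≤ (state x i h).phase.rank → ∃ S, Received i (.deliverSet S) h
  revealing : ∀ w, (state x i h).phase = .revealing w → Received i (.baaReturn w) h ∧
    ∀ j, Called x i (.enableRetrieve j) h ∧ (w j ≠ 0 → Called x i (.retrieve j) h)

/-- Until its corruption, each state change of a process comes from an event that `Received` and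
`Called` record. -/
theorem pastOf (hi : .corrupt i ∉ h) : PastOf x i h := by
  induction h with
  | nil =>
    constructor <;> simp [state, State.init, Phase.rank]
  | cons a h ih =>
    have hi' : .corrupt i ∉ h := fun e => hi (List.mem_cons_of_mem _ e)
    obtain ⟨p1, p2, p3, p4, p5⟩ := ih hi'
    rcases action_cases i a with rfl | ⟨m, rfl⟩ | ⟨h1, h2⟩
    · refine ⟨?_, ?_, ?_, ?_, ?_⟩ <;> simp only [state_toss, called_toss, Received] <;>
        generalize state x i h = s at * <;> rcases s with ⟨p, c, r⟩ <;>
        cases p <;> simp_all [next, calls, Phase.rank]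
    · cases m with
      | retrieveReturn l v =>
        have key : ∀ s : State n D, (next s (.response (.retrieveReturn l v))).phase = s.phase := by
          intro s; simp only [next]; split <;> rfl
        refine ⟨?_, ?_, ?_, ?_, ?_⟩ <;>
          simp only [state_notify, called_notify, Received, key]
        · intro j hj
          refine .inl (p1 j ?_)
          simp only [next] at hj
          split at hj <;> exact hj
        · intro j u hj
          simp only [next] at hj
          split at hj
          · by_cases e : j = l
            · subst e
              simp at hj
              subst hj
              exact .inr ⟨hi', rfl⟩
            · simp only [Function.update_of_ne e] at hj
              exact .inl (p2 j u hj)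
          · exact .inl (p2 j u hj)
        · exact fun hr => ⟨.inl (p3 hr).1, (p3 hr).2.imp fun _ => .inl⟩
        · exact fun hr => (p4 hr).imp fun _ => .inl
        · exact fun w hw => ⟨.inl (p5 w hw).1, fun j =>
            ⟨.inl ((p5 w hw).2 j).1, fun hj => .inl (((p5 w hw).2 j).2 hj)⟩⟩
      | sharingComplete l =>
        refine ⟨?_, ?_, ?_, ?_, ?_⟩ <;>
          simp only [state_notify, called_notify, Received]
        · intro j hj
          rcases Finset.mem_insert.1 hj with rfl | hj
          · exact .inr ⟨hi', rfl⟩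
          · exact .inl (p1 j hj)
        · exact fun j u hj => .inl (p2 j u hj)
        · exact fun hr => ⟨.inl (p3 hr).1, (p3 hr).2.imp fun _ => .inl⟩
        · exact fun hr => (p4 hr).imp fun _ => .inl
        · exact fun w hw => ⟨.inl (p5 w hw).1, fun j =>
            ⟨.inl ((p5 w hw).2 j).1, fun hj => .inl (((p5 w hw).2 j).2 hj)⟩⟩
      | deliverSet S =>
        refine ⟨?_, ?_, ?_, ?_, ?_⟩ <;>
          simp only [state_notify, called_notify, Received] <;>
          generalize state x i h = s at * <;> rcases s with ⟨p, c, r⟩ <;>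
          cases p <;> simp_all [next, calls, Phase.rank]
      | baaReturn S =>
        refine ⟨?_, ?_, ?_, ?_, ?_⟩ <;>
          simp only [state_notify, called_notify, Received] <;>
          generalize state x i h = s at * <;> rcases s with ⟨p, c, r⟩ <;>
          cases p <;> simp_all [next, calls, Phase.rank]
    · refine ⟨?_, ?_, ?_, ?_, ?_⟩ <;>
        simp only [state_cons_of_ne h1 h2, called_cons_of_ne h1 h2, Received]
      · exact fun j hj => .inl (p1 j hj)
      · exact fun j u hj => .inl (p2 j u hj)
      · exact p3
      · exact fun hr => (p4 hr).imp fun _ => .inl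
      · exact fun w hw => ⟨.inl (p5 w hw).1, (p5 w hw).2⟩

/-! ### Secrets -/

theorem secret_congr (hx : x j = x' j) : secret x j h = secret x' j h := by
  have hs : ∀ (h : History n D) (a : Action n D), shareArg x h j a = shareArg x' h j a := by
    intro h a
    cases a <;> simp only [shareArg, hx]
    rw [state_congr x x' j h]
  induction h with
  | nil => rfl
  | cons a h ih => simp only [secret, hs, ih]

/-- The secret of a non-corrupted leader, if shared, is the number that it drew. -/
theorem secret_of_not_corrupt (hj : .corrupt j ∉ h) :
    (∀ x : Fin n → Fin D, secret x j h = none) ∨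
      ∀ x : Fin n → Fin D, secret x j h = some (x j) := by
  induction h with
  | nil => exact .inl fun _ => rfl
  | cons a h ih =>
    have hj' : .corrupt j ∉ h := fun e => hj (List.mem_cons_of_mem _ e)
    have ih := ih hj'
    simp only [secret]
    split
    · exact ih
    · cases a with
      | toss k =>
        by_cases hk : k = j
        · subst hk
          rcases Nat.eq_zero_or_pos D with rfl | hD
          · exact .inl fun x => (x k).elim0
          · have x₀ : Fin n → Fin D := fun _ => ⟨0, hD⟩
            -- The control state is independent of the draws, so the phase at one arbitrary input
            -- decides which alternative holds for all inputs.
            by_cases hp : (state x₀ k h).phase = .idle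
            · right
              intro x
              rw [state_congr x₀ x] at hp
              simp [shareArg, hj', hp]
            · have hp' : ∀ x, (state x k h).phase ≠ .idle := fun x => state_congr x₀ x k h ▸ hp
              simpa [shareArg, hp'] using ih
        · simpa [shareArg, hk] using ih
      | _ => simpa [shareArg, hj'] using ih

theorem secret_cons_of_received (a : Action n D) (hr : Received k (.sharingComplete j) h) :
    secret x j (a :: h) = secret x j h := by
  rw [secret, if_pos ⟨k, hr⟩]

/-! ### Growing histories -/

/-- `H` starts with the empty history and grows by one event at a time. -/
structure Grows (H : ℕ → History n D) : Prop where
  zero : H 0 = []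
  succ : ∀ t, ∃ a, H (t + 1) = a :: H t

theorem grows_run (A : Adversary n D) (x : Fin n → Fin D) : Grows (run A x) :=
  ⟨rfl, fun _ => ⟨_, rfl⟩⟩

namespace Grows

theorem mono {P : History n D → Prop} (hH : Grows H) (hP : ∀ a h, P h → P (a :: h))
    (htt : t ≤ t') (ht : P (H t)) : P (H t') := by
  induction t', htt using Nat.le_induction with
  | base => exact ht
  | succ s _ ih =>
    obtain ⟨a, ha⟩ := hH.succ s
    rw [ha]
    exact hP a _ ih

theorem mem (hH : Grows H) (htt : t ≤ t') {a : Action n D} (ha : a ∈ H t) : a ∈ H t' :=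
  hH.mono (P := fun h => a ∈ h) (fun _ _ => List.mem_cons_of_mem _) htt ha

theorem received (hH : Grows H) (htt : t ≤ t') {m : Response n D} (hr : Received i m (H t)) :
    Received i m (H t') :=
  hH.mono (P := Received i m) (fun _ _ => .inl) htt hr

theorem secret_eq (hH : Grows H) (htt : t ≤ t') (hr : Received k (.sharingComplete j) (H t)) :
    secret x j (H t') = secret x j (H t) :=
  (hH.mono (P := fun h => Received k (.sharingComplete j) h ∧ secret x j h = secret x j (H t))
    (fun a _ hP => ⟨.inl hP.1, (secret_cons_of_received a hP.1).trans hP.2⟩) htt ⟨hr, rfl⟩).2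

/-- A received response was received at some moment. -/
theorem exists_notify (hH : Grows H) {m : Response n D} (hr : Received i m (H t)) :
    ∃ s < t, .corrupt i ∉ H s ∧ H (s + 1) = .notify i m :: H s := by
  induction t with
  | zero => rw [hH.zero] at hr; exact hr.elim
  | succ t ih =>
    obtain ⟨a, ha⟩ := hH.succ t
    rw [ha] at hr
    rcases hr with hr | ⟨hi, rfl⟩
    · obtain ⟨s, hs, h⟩ := ih hr
      exact ⟨s, by omega, h⟩
    · exact ⟨t, by omega, hi, ha⟩

/-- All corruptions have happened after finitely many events. -/
theorem exists_forall_correct (hH : Grows H) :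
    ∃ T, ∀ t ≥ T, ∀ i, .corrupt i ∉ H t → Correct H i := by
  have h1 : ∀ i, ∃ T, .corrupt i ∉ H T → Correct H i := by
    intro i
    by_cases hi : Correct H i
    · exact ⟨0, fun _ => hi⟩
    · obtain ⟨T, hT⟩ := not_forall.1 hi
      exact ⟨T, fun h => absurd h hT⟩
  choose T hT using h1
  refine ⟨Finset.univ.sup T, fun t ht i hi => hT i fun h => hi (hH.mem ?_ h)⟩
  exact (Finset.le_sup (Finset.mem_univ i)).trans ht

/-- The later of two first returns would have the earlier one in its past. -/
theorem firstReturn_unique (hH : Grows H) {w w' : Fin n → ℝ} (h1 : FirstReturn (H t) i w)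
    (h2 : FirstReturn (H t') k w') : t = t' := by
  have key : ∀ {t t' : ℕ} {i k : Fin n} {w w' : Fin n → ℝ},
      FirstReturn (H t) i w → FirstReturn (H t') k w' → ¬ t < t' := by
    rintro t t' i k w w' ⟨h1, e1, c1, -⟩ ⟨h2, e2, -, r2⟩ hlt
    obtain ⟨s, rfl⟩ := Nat.exists_eq_add_of_lt hlt
    obtain ⟨a, ha⟩ := hH.succ (t + s)
    rw [ha] at e2
    obtain ⟨-, rfl⟩ := List.cons.inj e2
    refine r2 i w (hH.received (Nat.le_add_right t s) ?_)
    rw [e1]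
    exact .inr ⟨c1, rfl⟩
  have := key h1 h2
  have := key h2 h1
  omega

end Grows

/-! ### Weights -/

theorem coinValue_congr {w : Fin n → ℝ} {y y' : Fin n → Option (Fin D)}
    (hy : ∀ j, w j ≠ 0 → y j = y' j) : coinValue w y = coinValue w y' := by
  refine congrArg (fun r : ℝ => ⌈r⌉ % (D : ℤ)) (Finset.sum_congr rfl fun j _ => ?_)
  by_cases hj : w j = 0
  · simp [hj]
  · rw [hy j hj]

theorem FirstReturn.received {w : Fin n → ℝ} (hw : FirstReturn h i w) :
    Received i (.baaReturn w) h ∧ .corrupt i ∉ h := by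
  obtain ⟨h', rfl, c, -⟩ := hw
  exact ⟨.inr ⟨c, rfl⟩, by simpa using c⟩

namespace IsExecution

/-- Weights obtained from BAA are `1` on a common core. -/
theorem weight_eq_one (hE : IsExecution f ε x H) {C : Finset (Fin n)}
    (hC : ∀ i, .corrupt i ∉ H t → ∀ S, Received i (.deliverSet S) (H t) → C ⊆ S)
    {w : Fin n → ℝ} (hi : .corrupt i ∉ H t) (hw : Received i (.baaReturn w) (H t)) (hj : j ∈ C) :
    w j = 1 := by
  have h1 : ∀ k u, .corrupt k ∉ H t → Called x k (.runBAA u) (H t) → u j = 1 := by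
    intro k u hk hu
    obtain ⟨S, rfl, hS⟩ := hu.exists_deliverSet
    simp [initialWeights, hC k hk S hS hj]
  obtain ⟨⟨k, u, hk, hu, hle⟩, k', u', hk', hu', hle'⟩ := hE.baa.validity t i w hi hw j
  rw [h1 k u hk hu] at hle
  rw [h1 k' u' hk' hu'] at hle'
  exact le_antisymm hle' hle

/-- A nonzero weight certifies that the sharing is complete at a non-corrupted process. -/
theorem exists_sharingComplete (hE : IsExecution f ε x H) {w : Fin n → ℝ} (hi : .corrupt i ∉ H t)
    (hw : Received i (.baaReturn w) (H t)) (hj : w j ≠ 0) :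
    ∃ k, .corrupt k ∉ H t ∧ Received k (.sharingComplete j) (H t) := by
  have h1 : ∀ k u, .corrupt k ∉ H t → Called x k (.runBAA u) (H t) → u j ≠ 0 →
      Received k (.sharingComplete j) (H t) := by
    intro k u hk hu hne
    obtain ⟨S, rfl, hS⟩ := hu.exists_deliverSet
    have hjS : j ∈ S := by
      by_contra hjS
      simp [initialWeights, hjS] at hne
    exact (pastOf hk).completed j (hE.gather.accepted t k S hk hS j hjS)
  -- Inputs are nonnegative, so a nonzero weight is positive, and the upper end of the input range
  -- yields a process whose input at `j` is nonzero.
  have h2 : ∀ k u, Called x k (.runBAA u) (H t) → 0 ≤ u j := by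
    intro k u hu
    obtain ⟨S, rfl, hS⟩ := hu.exists_deliverSet
    unfold initialWeights
    split <;> norm_num
  obtain ⟨⟨k, u, hk, hu, hle⟩, k', u', hk', hu', hle'⟩ := hE.baa.validity t i w hi hw j
  have h3 : 0 < w j := lt_of_le_of_ne ((h2 k u hu).trans hle) hj.symm
  exact ⟨k', hk', h1 k' u' hk' hu' (h3.trans_le hle').ne'⟩

/-- The values retrieved by non-corrupted processes are the secrets held by the AVSS instances. -/
theorem retrieved_eq_secret (hE : IsExecution f ε x H) {w : Fin n → ℝ} (hi : .corrupt i ∉ H t)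
    (hw : Received i (.baaReturn w) (H t)) (hj : w j ≠ 0)
    (hs : ((state x i (H t)).retrieved j).isSome) :
    (state x i (H t)).retrieved j = secret x j (H t) := by
  obtain ⟨v, hv⟩ := Option.isSome_iff_exists.1 hs
  obtain ⟨k, hk, hc⟩ := hE.exists_sharingComplete hi hw hj
  rw [hv, (hE.avss j).binding t k hk hc i v hi ((pastOf hi).retrieved j v hv)]

/-- A value returned by a non-corrupted process is determined by its weights and the secrets. -/
theorem output_eq (hE : IsExecution f ε x H)
    {v : ℤ} (hi : .corrupt i ∉ H t) (hv : output (state x i (H t)) = some v) :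
    ∃ w, Received i (.baaReturn w) (H t) ∧ v = coinValue w fun j => secret x j (H t) := by
  unfold output at hv
  split at hv
  · rename_i w hp
    split at hv
    · rename_i hall
      have hw := ((pastOf hi).revealing w hp).1
      refine ⟨w, hw, ?_⟩
      rw [← Option.some.inj hv]
      exact coinValue_congr fun j hj => hE.retrieved_eq_secret hi hw hj (hall j hj)
    · cases hv
  · cases hv

/-- The secrets with nonzero weight do not change after the return from BAA. -/
theorem coinValue_secret_eq (hE : IsExecution f ε x H)
    (hH : Grows H) {w : Fin n → ℝ} (htt : t ≤ t') (hi : .corrupt i ∉ H t)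
    (hw : Received i (.baaReturn w) (H t)) :
    (coinValue w fun j => secret x j (H t)) = coinValue w fun j => secret x j (H t') :=
  coinValue_congr fun _ hj =>
    let ⟨_, _, hk⟩ := hE.exists_sharingComplete hi hw hj
    (hH.secret_eq htt hk).symm

theorem baaReturn_unique (hE : IsExecution f ε x H) (hH : Grows H) {w w' : Fin n → ℝ}
    (h1 : Received i (.baaReturn w) (H t)) (h2 : Received i (.baaReturn w') (H t)) : w = w' := by
  obtain ⟨s, -, c, e⟩ := hH.exists_notify h1
  obtain ⟨s', -, c', e'⟩ := hH.exists_notify h2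
  rcases lt_trichotomy s s' with hlt | rfl | hlt
  · refine absurd (hH.received (t' := s') (Nat.succ_le_of_lt hlt) ?_)
      ((hE.baa.return_once s' i w' c' e').2 w)
    rw [e]
    exact .inr ⟨c, rfl⟩
  · rw [e] at e'
    simpa using (List.cons.inj e').1
  · refine absurd (hH.received (t' := s) (Nat.succ_le_of_lt hlt) ?_)
      ((hE.baa.return_once s i w c e).2 w')
    rw [e']
    exact .inr ⟨c', rfl⟩

/-- A non-corrupted process that returned from BAA goes on to reveal the secrets. -/
theorem phase_eq_revealing (hE : IsExecution f ε x H)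
    (hH : Grows H) {w : Fin n → ℝ} (hw : Received i (.baaReturn w) (H t)) :
    (state x i (H t)).phase = .revealing w := by
  obtain ⟨s, hs, c, e⟩ := hH.exists_notify hw
  obtain ⟨⟨u, hu⟩, hn⟩ := hE.baa.return_once s i w c e
  refine hH.mono (P := fun h => (state x i h).phase = .revealing w)
    (fun a h => phase_revealing_cons a) (Nat.succ_le_of_lt hs) ?_
  have h2 := hu.two_le_rank
  have h3 : ∀ w', (state x i (H s)).phase ≠ .revealing w' := fun w' h =>
    hn w' ((pastOf c).revealing w' h).1
  simp only [Nat.succ_eq_add_one, e, state_notify]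
  generalize state x i (H s) = q at *
  rcases q with ⟨p, _, _⟩
  cases p <;> simp_all [next, Phase.rank]

/-! ### Termination -/

theorem exists_called_runBAA (hE : IsExecution f ε x H) (hH : Grows H) {S : Finset (Fin n)}
    (hS : Received i (.deliverSet S) (H t)) : ∃ t u, Called x i (.runBAA u) (H t) := by
  obtain ⟨s, -, c, e⟩ := hH.exists_notify hS
  obtain ⟨hg, hn⟩ := hE.gather.deliver_once s i S c e
  refine ⟨s + 1, initialWeights S, ?_⟩
  have h1 := hg.one_le_rank
  have h2 : ¬ 2 ≤ (state x i (H s)).phase.rank := fun h =>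
    let ⟨S', hS'⟩ := (pastOf c).delivered h
    hn S' hS'
  rw [e, called_notify]
  refine .inr ⟨c, ?_⟩
  generalize state x i (H s) = q at *
  rcases q with ⟨p, _, _⟩
  cases p <;> simp_all [calls, Phase.rank]

/-- The liveness guarantees chain up: AVSS validity and totality provide the acceptance conditions
of Gather, delivery by Gather provides the inputs of BAA, and BAA then terminates. -/
theorem exists_baaReturn (hE : IsExecution f ε x H) (hH : Grows H) (hi : Correct H i) :
    ∃ t w, Received i (.baaReturn w) (H t) := by
  have h1 : ∀ i, Correct H i → ∃ t, Called x i .startGather (H t) ∧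
      ∃ v, Called x i (.shareSecret v) (H t) := fun i hi =>
    let ⟨t, ht⟩ := hE.participate i hi
    ⟨t, (pastOf (hi t)).started (one_le_rank_of_toss_mem ht)⟩
  have hval : AcceptValidity x H := by
    refine ⟨fun i hi _ k hk => ?_, fun i k _ t t' htt => ?_⟩
    · obtain ⟨t, -, v, hv⟩ := h1 i hi
      obtain ⟨t', ht'⟩ := (hE.avss i).validity hi t v hv k hk
      exact ⟨t', ht'.mem_completed⟩
    · exact hH.mono (P := Accept x k i) (fun a _ ha => completed_subset_cons a ha) htt
  have htot : AcceptTotality x H := by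
    rintro i k hk ⟨t, ht⟩ l hl
    obtain ⟨t', ht'⟩ := (hE.avss i).totality t k hk ((pastOf (hk t)).completed i ht) l hl
    exact ⟨t', ht'.mem_completed⟩
  refine hE.baa.termination (fun k hk => ?_) i hi
  obtain ⟨t, S, hS⟩ :=
    hE.gather.termination hval htot (fun k hk => (h1 k hk).imp fun _ => And.left) k hk
  exact hE.exists_called_runBAA hH hS

theorem termination (hE : IsExecution f ε x H) (hH : Grows H) : Termination x H := by
  intro i hi
  obtain ⟨t, w, hw⟩ := hE.exists_baaReturn hH hi
  have hen : ∀ j i, Correct H i → ∃ t, Called x i (.enableRetrieve j) (H t) := by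
    intro j i hi
    obtain ⟨t, w, hw⟩ := hE.exists_baaReturn hH hi
    exact ⟨t, (((pastOf (hi t)).revealing w (hE.phase_eq_revealing hH hw)).2 j).1⟩
  -- Nonzero weights only yield a completed sharing at a process not corrupted so far, while
  -- retrieval needs one at a correct process. After time `T` the two notions agree.
  obtain ⟨T, hT⟩ := hH.exists_forall_correct
  have hret : ∀ j, ∃ s, w j ≠ 0 → ((state x i (H s)).retrieved j).isSome := by
    intro j
    by_cases hj : w j = 0
    · exact ⟨0, fun h => absurd hj h⟩
    · obtain ⟨k, hk, hc⟩ := hE.exists_sharingComplete (hi (max t T))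
        (hH.received (le_max_left t T) hw) hj
      obtain ⟨s, v, hs⟩ := (hE.avss j).retrieve_termination
        ⟨_, k, hT _ (le_max_right t T) k hk, hc⟩ (hen j) i hi
        ⟨t, (((pastOf (hi t)).revealing w (hE.phase_eq_revealing hH hw)).2 j).2 hj⟩
      exact ⟨s, fun _ => hs.isSome_retrieved⟩
  choose s hs using hret
  refine ⟨coinValue w (state x i (H (max t (Finset.univ.sup s)))).retrieved,
    max t (Finset.univ.sup s), ?_⟩
  simp only [output, hE.phase_eq_revealing hH (hH.received (le_max_left _ _) hw)]
  refine if_pos fun j hj => ?_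
  refine hH.mono (P := fun h => ((state x i h).retrieved j).isSome)
    (fun a h => isSome_retrieved_cons a) ?_ (hs j hj)
  exact (Finset.le_sup (Finset.mem_univ j)).trans (le_max_right _ _)

/-! ### The first process to return from BAA -/

theorem exists_not_corrupt (hE : IsExecution f ε x H)
    {C : Finset (Fin n)} (hC : f < C.card) (t : ℕ) :
    ∃ i ∈ C, .corrupt i ∉ H t := by
  by_contra! hall
  have h1 := hE.corrupt_le t
  have h2 : (C : Set (Fin n)).ncard ≤ {i : Fin n | .corrupt i ∈ H t}.ncard :=
    Set.ncard_le_ncard (fun i hi => hall i hi) (Set.toFinite _)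
  rw [Set.ncard_coe_finset] at h2
  omega

theorem exists_correct (hE : IsExecution f ε x H)
    (hf : f < n) (hH : Grows H) : ∃ i, Correct H i := by
  obtain ⟨T, hT⟩ := hH.exists_forall_correct
  obtain ⟨i, -, hi⟩ := hE.exists_not_corrupt (C := Finset.univ) (by simpa using hf) T
  exact ⟨i, hT T le_rfl i hi⟩

theorem exists_firstReturn (hE : IsExecution f ε x H)
    (hf : f < n) (hH : Grows H) : ∃ t i w, FirstReturn (H t) i w := by
  classical
  obtain ⟨i, hi⟩ := hE.exists_correct hf hH
  have hex : ∃ t i w, Received i (.baaReturn w) (H t) :=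
    let ⟨t, w, hw⟩ := hE.exists_baaReturn hH hi
    ⟨t, i, w, hw⟩
  -- At the earliest time with a recorded return, minimality rules out any return before the event
  -- that caused it.
  obtain ⟨i, w, hw⟩ := Nat.find_spec hex
  obtain ⟨s, hs, c, e⟩ := hH.exists_notify hw
  exact ⟨s + 1, i, w, H s, e, c, fun k u hr => Nat.find_min hex hs ⟨k, u, hr⟩⟩

theorem outputs_iff (hE : IsExecution f ε x H)
    (hH : Grows H) {w : Fin n → ℝ} (hw : FirstReturn (H t) i w)
    (hi : Correct H i) (v : ℤ) :
    Outputs x H i v ↔ v = coinValue w fun j => secret x j (H t) := by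
  have hr := (FirstReturn.received hw).1
  have key : ∀ v, Outputs x H i v → v = coinValue w fun j => secret x j (H t) := by
    rintro v ⟨s, hs⟩
    obtain ⟨w', hw', rfl⟩ := hE.output_eq (hi s) hs
    obtain rfl : w' = w := hE.baaReturn_unique hH (hH.received (le_max_left s t) hw')
      (hH.received (le_max_right s t) hr)
    rw [hE.coinValue_secret_eq hH (le_max_left s t) (hi s) hw',
      hE.coinValue_secret_eq hH (le_max_right s t) (hi t) hr]
  refine ⟨key v, ?_⟩
  -- Some value is returned by termination, and `key` identifies it.
  rintro rfl
  obtain ⟨v, hv⟩ := hE.termination hH i hi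
  exact key v hv ▸ hv

end IsExecution

/-! ### Consistency -/

/-- The difference a − b equals that of the residues plus a multiple qm. If m = 0 the first term of
the minimum works; otherwise |a − b| is at least q minus the distance of the residues. -/
theorem ringDist_emod_le {q : ℤ} (hq : 0 < q) (a b : ℤ) : ringDist q (a % q) (b % q) ≤ |a - b| := by
  have ha := Int.emod_add_mul_ediv a q
  have hb := Int.emod_add_mul_ediv b q
  have ha0 := Int.emod_nonneg a hq.ne'
  have hb0 := Int.emod_nonneg b hq.ne'
  have ha1 := Int.emod_lt_of_pos a hq
  have hb1 := Int.emod_lt_of_pos b hq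
  set r := a % q
  set s := b % q
  have e : a - b = (r - s) + q * (a / q - b / q) := by linear_combination -ha + hb
  generalize a / q - b / q = m at e
  rw [e, ringDist]
  rcases lt_trichotomy m 0 with hm | rfl | hm
  · refine (min_le_right _ _).trans ?_
    have : q * m ≤ -q := by nlinarith
    have h1 := le_abs_self (r - s)
    have h2 := neg_abs_le (r - s + q * m)
    have h3 := neg_abs_le (r - s)
    have h4 : |r - s| ≤ q := abs_le.2 ⟨by omega, by omega⟩
    rcases abs_cases (r - s) with h | h <;> omega
  · simp
  · refine (min_le_right _ _).trans ?_
    have : q ≤ q * m := by nlinarith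
    have h1 := le_abs_self (r - s + q * m)
    rcases abs_cases (r - s) with h | h <;> omega

/-- The real number from which the coin value is computed. -/
def weightedSum (w : Fin n → ℝ) (y : Fin n → Option (Fin D)) : ℝ :=
  ∑ j, (y j).elim 0 (fun v => ((v : ℕ) : ℝ)) * w j

theorem coinValue_eq (w : Fin n → ℝ) (y : Fin n → Option (Fin D)) :
    coinValue w y = ⌈weightedSum w y⌉ % (D : ℤ) := by
  refine congrArg (fun r : ℝ => ⌈r⌉ % (D : ℤ)) (Finset.sum_congr rfl fun j _ => ?_)
  by_cases hj : w j = 0 <;> simp [hj]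

/-- Only the at most `f` indices outside `C` contribute, each at most `D` times the precision. For
`f = 0` there are none, so replacing `f` by 1 is harmless. -/
theorem abs_weightedSum_sub_le (hε : 0 ≤ ε) {C : Finset (Fin n)} (hC : n ≤ C.card + f)
    {w w' : Fin n → ℝ} (h1 : ∀ j ∈ C, w j = w' j)
    (h2 : ∀ j, |w j - w' j| ≤ ε / (max f 1 : ℕ)) (y : Fin n → Option (Fin D)) :
    |weightedSum w y - weightedSum w' y| ≤ ε * D := by
  have hy : ∀ j, |(y j).elim (0 : ℝ) (fun v => ((v : ℕ) : ℝ))| ≤ D := by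
    intro j
    rcases y j with _ | v
    · simp
    · simp
  have hcard : (Cᶜ.card : ℝ) ≤ (max f 1 : ℕ) := by
    rw [Finset.card_compl, Fintype.card_fin]
    exact_mod_cast (show n - C.card ≤ max f 1 by omega)
  have hpos : (0 : ℝ) < (max f 1 : ℕ) := by positivity
  unfold weightedSum
  rw [← Finset.sum_sub_distrib, ← Finset.sum_add_sum_compl C, Finset.sum_eq_zero, zero_add]
  · refine (Finset.abs_sum_le_sum_abs _ _).trans ?_
    refine (Finset.sum_le_card_nsmul _ _ (D * (ε / (max f 1 : ℕ))) fun j _ => ?_).trans ?_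
    · rw [← mul_sub, abs_mul]
      exact mul_le_mul (hy j) (h2 j) (abs_nonneg _) (Nat.cast_nonneg _)
    · rw [nsmul_eq_mul]
      refine (mul_le_mul_of_nonneg_right hcard (by positivity)).trans_eq ?_
      field_simp
  · intro j hj
    rw [h1 j hj, sub_self]

theorem IsExecution.approxConsistency (hE : IsExecution f ε x H) (hH : Grows H) (hε : 0 ≤ ε)
    (hD : 0 < D) : ApproxConsistency ε x H := by
  rintro i k hi hk a b ⟨s, hs⟩ ⟨s', hs'⟩
  obtain ⟨w, hw, rfl⟩ := hE.output_eq (hi s) hs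
  obtain ⟨w', hw', rfl⟩ := hE.output_eq (hk s') hs'
  -- Both values are moved to a common time, so that they use the same secrets and the same core.
  obtain ⟨T, hsT, hsT'⟩ : ∃ T, s ≤ T ∧ s' ≤ T := ⟨_, le_max_left s s', le_max_right s s'⟩
  have hwT := hH.received hsT hw
  have hwT' := hH.received hsT' hw'
  obtain ⟨C, hC, hsub⟩ := hE.gather.common_core T
  rw [hE.coinValue_secret_eq hH hsT (hi s) hw,
    hE.coinValue_secret_eq hH hsT' (hk s') hw', coinValue_eq, coinValue_eq]
  refine (ringDist_emod_le (by exact_mod_cast hD) _ _).trans ?_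
  have hle := abs_weightedSum_sub_le hε hC (w := w) (w' := w')
    (fun j hj => (hE.weight_eq_one hsub (hi T) hwT hj).trans
      (hE.weight_eq_one hsub (hk T) hwT' hj).symm)
    (hE.baa.consistency T i k w w' (hi T) (hk T) hwT hwT') (fun j => secret x j (H T))
  have hceil : ∀ p q : ℝ, p - q ≤ ε * D → ⌈p⌉ - ⌈q⌉ ≤ ⌈ε * D⌉ := by
    intro p q hpq
    have := (Int.ceil_mono (show p ≤ q + ε * D by linarith)).trans (Int.ceil_add_le q (ε * D))
    omega
  rw [abs_le] at hle
  rw [abs_le]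
  have h1 := hceil _ _ hle.2
  have h2 := hceil (weightedSum w' fun j => secret x j (H T))
    (weightedSum w fun j => secret x j (H T)) (by linarith [hle.1])
  constructor <;> omega

variable {A : Adversary n D}

/-! ### Hidden secrets -/

/-- The history `h` ends with the first return from BAA, `j` has weight `1` in it, and the secret
of `AVSS_j` is the number drawn by `j`, which the adversary does not know. -/
def Pivot (h : History n D) (j : Fin n) : Prop :=
  .corrupt j ∉ h ∧ (∃ i w, FirstReturn h i w ∧ w j = 1) ∧
    ∀ x : Fin n → Fin D, secret x j h = some (x j)

/-- The core has at least n − f > f ids, hence a non-corrupted one. Its weight 1 certifies a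
completed sharing, so its secret exists and must be its own draw. -/
theorem IsExecution.exists_pivot (hE : IsExecution f ε x H) (hH : Grows H) (hf : 3 * f < n) :
    ∃ t j, Pivot (H t) j := by
  obtain ⟨t, i, w, hw⟩ := hE.exists_firstReturn (by omega) hH
  obtain ⟨hr, hi⟩ := FirstReturn.received hw
  obtain ⟨C, hC, hsub⟩ := hE.gather.common_core t
  obtain ⟨j, hj, hjt⟩ := hE.exists_not_corrupt (C := C) (by omega) t
  have hwj := hE.weight_eq_one hsub hi hr hj
  refine ⟨t, j, hjt, ⟨i, w, hw, hwj⟩, ?_⟩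
  obtain ⟨k, hk, hc⟩ := hE.exists_sharingComplete hi hr (j := j) (by simp [hwj])
  have hs := (hE.avss j).complete_shared t k hk hc
  refine (secret_of_not_corrupt hjt).resolve_left fun hn => ?_
  simp [hn x] at hs

theorem called_enableRetrieve_congr (x x' : Fin n → Fin D) :
    Called x i (.enableRetrieve j) h ↔ Called x' i (.enableRetrieve j) h := by
  induction h with
  | nil => rfl
  | cons a h ih =>
    rcases action_cases i a with rfl | ⟨m, rfl⟩ | ⟨h1, h2⟩
    · simp only [called_toss, ih, state_congr x x' i h]
      simp only [calls]
      split <;> simp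
    · simp only [called_notify, ih, state_congr x x' i h]
    · simp only [called_cons_of_ne h1 h2, ih]

/-- Until the first return from BAA, the execution does not depend on hidden secrets. -/
theorem run_eq_of_pivot (hp : Pivot (run A x t) j) (hx : ∀ l ≠ j, x' l = x l) :
    run A x' t = run A x t := by
  obtain ⟨hc, ⟨i, w, ⟨h', e, -, hn⟩, -⟩, -⟩ := hp
  have hH := grows_run A x
  suffices ∀ s ≤ t, run A x' s = run A x s from this t le_rfl
  intro s
  induction s with
  | zero => exact fun _ => rfl
  | succ s ih =>
    intro hs
    have hno : ∀ k u, ¬ Received k (.baaReturn u) (run A x s) := by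
      intro k u hr
      obtain ⟨t, rfl⟩ : ∃ r, t = r + 1 := ⟨t - 1, by omega⟩
      obtain ⟨a, ha⟩ := hH.succ t
      rw [ha] at e
      obtain ⟨-, rfl⟩ := List.cons.inj e
      exact hn k u (hH.received (by omega) hr)
    have hk : knownSecrets x' (run A x s) = knownSecrets x (run A x s) := by
      funext l
      have hcall : (∃ i, Called x' i (.enableRetrieve l) (run A x s)) ↔
          ∃ i, Called x i (.enableRetrieve l) (run A x s) :=
        exists_congr fun _ => called_enableRetrieve_congr x' x
      simp only [knownSecrets]
      -- At `j` the adversary sees `none` in both runs: `j` is not corrupted, and enabling retrieval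
      -- would need an earlier return from BAA.
      by_cases hl : l = j
      · subst hl
        rw [if_neg, if_neg] <;>
        · rintro (h1 | ⟨k, hk⟩)
          · exact hc (hH.mem (by omega) h1)
          · obtain ⟨w, hw⟩ := hk.exists_baaReturn
            exact hno k w hw
      · rw [hx l hl]
        split_ifs <;> tauto
    simp only [run, ih (by omega), hk]

/-- Weight exactly 1 makes the draw of `j` an integer summand, which leaves the ceiling; the other
secrets do not depend on it. -/
theorem coinValue_update [NeZero D] (x : Fin n → Fin D) (c : Fin D) (hp : Pivot h j)
    {w : Fin n → ℝ} (hw : w j = 1) :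
    (coinValue w fun l => secret (Function.update x j (x j + c)) l h) =
      ((coinValue w fun l => secret x l h) + (c : ℕ)) % D := by
  have hs := hp.2.2
  have e : ∀ x : Fin n → Fin D, weightedSum w (fun l => secret x l h) =
      (∑ l ∈ Finset.univ.erase j,
        (secret x l h).elim 0 (fun v => ((v : ℕ) : ℝ)) * w l) + ((x j : ℕ) : ℤ) := by
    intro x
    rw [weightedSum, ← Finset.sum_erase_add _ _ (Finset.mem_univ j), hs x, hw]
    simp
  rw [coinValue_eq, coinValue_eq, e, e x, Int.ceil_add_intCast, Int.ceil_add_intCast,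
    Finset.sum_congr rfl fun l hl => by
      rw [secret_congr (x' := x) (Function.update_of_ne (Finset.ne_of_mem_erase hl) _ _)]]
  simp [Fin.val_add, add_assoc]

/-! ### The coin as a function of the draws, and its shift under rotation. -/

/-- `v` is the value of the process that is the first to return from BAA. -/
def CoinIs (A : Adversary n D) (x : Fin n → Fin D) (v : Fin D) : Prop :=
  ∃ i, FirstValue x (run A x) i (v : ℕ)

theorem CoinIs.unique {v v' : Fin D} (h1 : CoinIs A x v) (h2 : CoinIs A x v') : v = v' := by
  obtain ⟨i, t, w, hw, e⟩ := h1
  obtain ⟨i', t', w', hw', e'⟩ := h2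
  obtain rfl := (grows_run A x).firstReturn_unique hw hw'
  obtain ⟨h, eh, -⟩ := hw
  obtain ⟨h', eh', -⟩ := hw'
  rw [eh] at eh'
  obtain rfl : w = w' := by simpa using (Action.notify.inj (List.cons.inj eh').1).2
  rw [← e'] at e
  exact Fin.ext (by exact_mod_cast e)

theorem exists_coinIs [NeZero D] (hp : Pivot (run A x t) j) : ∃ v, CoinIs A x v := by
  obtain ⟨-, ⟨i, w, hw, -⟩, -⟩ := hp
  have hD : (0 : ℤ) < D := by exact_mod_cast NeZero.pos D
  have h0 : 0 ≤ coinValue w fun l => secret x l (run A x t) := Int.emod_nonneg _ hD.ne'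
  have h1 : (coinValue w fun l => secret x l (run A x t)) < D := Int.emod_lt_of_pos _ hD
  exact ⟨⟨(coinValue w fun l => secret x l (run A x t)).toNat, by omega⟩, i, t, w, hw, by simp [h0]⟩

theorem Pivot.update (hp : Pivot (run A x t) j) (a : Fin D) :
    run A (Function.update x j a) t = run A x t :=
  run_eq_of_pivot hp fun _ hl => Function.update_of_ne hl _ _

theorem CoinIs.update [NeZero D] {v : Fin D} (hv : CoinIs A x v) (hp : Pivot (run A x t) j)
    (c : Fin D) : CoinIs A (Function.update x j (x j + c)) (v + c) := by
  obtain ⟨i, s, w, hw, e⟩ := hv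
  obtain ⟨-, ⟨i', w', hw', hj⟩, -⟩ := id hp
  obtain rfl := (grows_run A x).firstReturn_unique hw hw'
  refine ⟨i, s, w, by rwa [hp.update], ?_⟩
  have hww : w = w' := by
    obtain ⟨h, eh, -⟩ := hw
    obtain ⟨h', eh', -⟩ := hw'
    rw [eh] at eh'
    simpa using (Action.notify.inj (List.cons.inj eh').1).2
  rw [hp.update, coinValue_update x c hp (hww ▸ hj), ← e]
  simp [Fin.val_add]

/-! ### Counting -/

/-- There is a moment with a hidden secret of weight `1`. -/
def Fair (A : Adversary n D) (x : Fin n → Fin D) : Prop := ∃ t j, Pivot (run A x t) j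

/-- A hidden secret of weight `1` after the history `h`. -/
noncomputable def pivot (h : History n D) (hh : ∃ j, Pivot h j) : Fin n := hh.choose

/-- Rotation of the hidden secret by `c`. -/
noncomputable def rotate (A : Adversary n D) (c : Fin D) (x : {x // Fair A x}) : Fin n → Fin D :=
  let j := pivot _ x.2.choose_spec
  Function.update x.1 j (x.1 j + c)

theorem Pivot.time_unique (h1 : Pivot (run A x t) j) (h2 : Pivot (run A x t') k) : t = t' := by
  obtain ⟨-, ⟨i, w, hw, -⟩, -⟩ := h1
  obtain ⟨-, ⟨i', w', hw', -⟩, -⟩ := h2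
  exact (grows_run A x).firstReturn_unique hw hw'

theorem pivot_spec (x : {x // Fair A x}) :
    Pivot (run A x.1 x.2.choose) (pivot _ x.2.choose_spec) :=
  x.2.choose_spec.choose_spec

theorem run_rotate (c : Fin D) (x : {x // Fair A x}) :
    run A (rotate A c x) x.2.choose = run A x.1 x.2.choose :=
  (pivot_spec x).update _

theorem pivot_rotate (c : Fin D) (x : {x // Fair A x}) :
    Pivot (run A (rotate A c x) x.2.choose) (pivot _ x.2.choose_spec) := by
  rw [run_rotate]
  exact pivot_spec x

/-- The rotated input has the same history up to the first return, and both the time and the pivot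
can be recovered from it since `pivot` depends only on the history. So the rotation can be undone.
-/
theorem rotate_injective [NeZero D] (c : Fin D) : Function.Injective (rotate A c) := by
  intro x y hxy
  have ht : x.2.choose = y.2.choose := by
    have hx := pivot_rotate c x
    rw [hxy] at hx
    exact hx.time_unique (pivot_rotate c y)
  have hh : run A x.1 x.2.choose = run A y.1 y.2.choose := by
    rw [← run_rotate c x, ← run_rotate c y, hxy, ht]
  have hj : pivot _ x.2.choose_spec = pivot _ y.2.choose_spec := by
    congr 1
  refine Subtype.ext (funext fun l => ?_)
  have hl := congrFun hxy l
  simp only [rotate, ← hj] at hl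
  by_cases e : l = pivot _ x.2.choose_spec
  · subst e
    simpa using hl
  · simpa [Function.update_of_ne e] using hl

open Classical in
-- Rotating by `v' - v` injects one set into the other; by symmetry all values are equally frequent.
theorem card_coinIs_le [NeZero D] (A : Adversary n D) (v v' : Fin D) :
    (Finset.univ.filter fun x => Fair A x ∧ CoinIs A x v).card ≤
      (Finset.univ.filter fun x => Fair A x ∧ CoinIs A x v').card := by
  refine Finset.card_le_card_of_injOn
    (fun x => if hx : Fair A x then rotate A (v' - v) ⟨x, hx⟩ else x) ?_ ?_
  · intro x hx
    simp only [Finset.coe_filter, Finset.mem_univ, true_and, Set.mem_ofPred_eq] at hx ⊢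
    rw [dif_pos hx.1]
    refine ⟨⟨_, _, pivot_rotate _ _⟩, ?_⟩
    have := hx.2.update (pivot_spec ⟨x, hx.1⟩) (v' - v)
    rwa [add_sub_cancel] at this
  · intro x hx y hy hxy
    simp only [Finset.coe_filter, Finset.mem_univ, true_and, Set.mem_ofPred_eq] at hx hy hxy
    rw [dif_pos hx.1, dif_pos hy.1] at hxy
    exact congrArg Subtype.val (rotate_injective _ hxy)

open Classical in
/-- On the fair random inputs the coin is uniform. -/
theorem card_coinIs_mem [NeZero D] (A : Adversary n D) (B : Finset (Fin D)) :
    D * (Finset.univ.filter fun x => Fair A x ∧ ∃ v ∈ B, CoinIs A x v).card =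
      B.card * (Finset.univ.filter fun x => Fair A x).card := by
  have key : ∀ B : Finset (Fin D),
      (Finset.univ.filter fun x => Fair A x ∧ ∃ v ∈ B, CoinIs A x v).card =
        B.card * (Finset.univ.filter fun x => Fair A x ∧ CoinIs A x 0).card := by
    intro B
    have : (Finset.univ.filter fun x => Fair A x ∧ ∃ v ∈ B, CoinIs A x v) =
        B.biUnion fun v => Finset.univ.filter fun x => Fair A x ∧ CoinIs A x v := by
      ext x
      simp only [Finset.mem_filter, Finset.mem_univ, true_and, Finset.mem_biUnion]
      tauto
    rw [this, Finset.card_biUnion]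
    · rw [Finset.sum_congr rfl fun v _ => le_antisymm (card_coinIs_le A v 0) (card_coinIs_le A 0 v)]
      simp
    · intro v _ v' _ hne
      rw [Function.onFun, Finset.disjoint_left]
      intro x hx hx'
      simp only [Finset.mem_filter] at hx hx'
      exact hne (hx.2.2.unique hx'.2.2)
  -- Every fair input has a coin value, so `key` with the full value set counts all fair inputs.
  have hall : (Finset.univ.filter fun x => Fair A x) =
      Finset.univ.filter fun x =>
        Fair A x ∧ ∃ v ∈ (Finset.univ : Finset (Fin D)), CoinIs A x v := by
    refine Finset.filter_congr fun x _ => ⟨fun hx => ⟨hx, ?_⟩, And.left⟩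
    obtain ⟨t, j, hp⟩ := hx
    obtain ⟨v, hv⟩ := exists_coinIs hp
    exact ⟨v, Finset.mem_univ v, hv⟩
  rw [hall, key, key, Finset.card_univ, Fintype.card_fin]
  ring

/-! ### Probabilities -/

instance [NeZero D] : IsProbabilityMeasure (localRandomness n D) := by
  unfold localRandomness
  infer_instance

theorem localRandomness_real [NeZero D] (P : (Fin n → Fin D) → Prop) [DecidablePred P] :
    (localRandomness n D).real {x | P x} = (Finset.univ.filter P).card / (D : ℝ) ^ n := by
  have h1 : ∀ x : Fin n → Fin D, (localRandomness n D).real {x} = ((D : ℝ) ^ n)⁻¹ := by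
    intro x
    simp [localRandomness, measureReal_def, Measure.pi_singleton]
  have h2 : {x | P x} = ((Finset.univ.filter P : Finset (Fin n → Fin D)) : Set _) := by simp
  rw [h2, ← sum_measureReal_singleton, Finset.sum_congr rfl fun x _ => h1 x]
  simp [div_eq_mul_inv]

/-- Here `N` counts all inputs, `c` the unfair ones, `p` the favourable ones and `q` those both fair
and favourable. The deviation times `N` is (p − q) − (b/d)c, and both terms lie in [0, c]. -/
theorem abs_div_sub_div_le {p q c b d N : ℝ} (hd : 0 < d) (hN : 0 < N) (hb : 0 ≤ b) (hc : 0 ≤ c)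
    (hbd : b ≤ d) (hqp : q ≤ p) (hpq : p ≤ q + c) (h : d * q = b * (N - c)) :
    |p / N - b / d| ≤ c / N := by
  have e : b / d = (q + b / d * c) / N := by
    field_simp
    linear_combination -h
  have h1 : b / d * c ≤ c := mul_le_of_le_one_left hc ((div_le_one hd).2 hbd)
  have h0 : 0 ≤ b / d * c := by positivity
  rw [e, ← sub_div, abs_div, abs_of_pos hN]
  refine div_le_div_of_nonneg_right (abs_le.2 ⟨?_, ?_⟩) hN.le <;> linarith

/-- For a deterministic adversary, the distribution of the coin differs from the uniform one by at
most the probability that there is no hidden secret of weight `1`. -/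
theorem abs_localRandomness_sub_le [NeZero D] (A : Adversary n D) (B : Finset (Fin D)) :
    |(localRandomness n D).real {x | ∃ v ∈ B, CoinIs A x v} - (B.card : ℝ) / D| ≤
      (localRandomness n D).real {x | ¬ Fair A x} := by
  classical
  set P : (Fin n → Fin D) → Prop := fun x => ∃ v ∈ B, CoinIs A x v
  have hD : (0 : ℝ) < D := by exact_mod_cast NeZero.pos D
  have hDn : (0 : ℝ) < (D : ℝ) ^ n := by positivity
  have hB : (B.card : ℝ) ≤ D := by
    exact_mod_cast (Finset.card_le_univ B).trans_eq (Fintype.card_fin D)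
  have h1 : (D : ℝ) * (Finset.univ.filter fun x => Fair A x ∧ P x).card =
      B.card * (Finset.univ.filter fun x => Fair A x).card := by
    exact_mod_cast card_coinIs_mem A B
  have h2 : ((Finset.univ.filter fun x => Fair A x).card : ℝ) +
      (Finset.univ.filter fun x => ¬ Fair A x).card = (D : ℝ) ^ n := by
    have := Finset.card_filter_add_card_filter_not (s := (Finset.univ : Finset (Fin n → Fin D)))
      (fun x => Fair A x)
    rw [Finset.card_univ, Fintype.card_fun, Fintype.card_fin, Fintype.card_fin] at this
    exact_mod_cast this
  have h3 : (Finset.univ.filter fun x => Fair A x ∧ P x).card ≤ (Finset.univ.filter P).card :=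
    Finset.card_le_card fun x hx => by simp_all
  have h4 : (Finset.univ.filter P).card ≤ (Finset.univ.filter fun x => Fair A x ∧ P x).card +
      (Finset.univ.filter fun x => ¬ Fair A x).card := by
    refine le_trans (Finset.card_le_card fun x hx => ?_) (Finset.card_union_le _ _)
    simp only [Finset.mem_union, Finset.mem_filter, Finset.mem_univ, true_and] at hx ⊢
    by_cases hF : Fair A x
    · exact .inl ⟨hF, hx⟩
    · exact .inr hF
  have h3' : ((Finset.univ.filter fun x => Fair A x ∧ P x).card : ℝ) ≤
      (Finset.univ.filter P).card := by
    exact_mod_cast h3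
  have h4' : ((Finset.univ.filter P).card : ℝ) ≤
      (Finset.univ.filter fun x => Fair A x ∧ P x).card +
      (Finset.univ.filter fun x => ¬ Fair A x).card := by
    exact_mod_cast h4
  rw [localRandomness_real, localRandomness_real]
  exact abs_div_sub_div_le hD hDn (Nat.cast_nonneg _) (Nat.cast_nonneg _) hB h3' h4'
    (by rw [h1, ← h2, add_sub_cancel_right])

/-- The distribution of the coin against a randomized adversary. -/
theorem abs_prod_real_sub_le [NeZero D] (hf : 3 * f < n)
    {Ω : Type*} [MeasurableSpace Ω] (μ : Measure Ω) [IsProbabilityMeasure μ]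
    (A : Ω → Adversary n D)
    (hA : ∀ x v, MeasurableSet {ω | CoinIs (A ω) x v}) (η : ℝ≥0)
    (hη : (μ.prod (localRandomness n D)) {p | ¬ IsExecution f ε p.2 (run (A p.1) p.2)} ≤ η)
    (B : Finset (Fin D)) :
    |(μ.prod (localRandomness n D)).real {p | ∃ v ∈ B, CoinIs (A p.1) p.2 v} -
      (B.card : ℝ) / D| ≤ η := by
  set ν := localRandomness n D
  set S := {p : Ω × (Fin n → Fin D) | ∃ v ∈ B, CoinIs (A p.1) p.2 v}
  -- The exceptional event need not be measurable; a measurable hull of the same measure allows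
  -- slicing.
  set N := toMeasurable (μ.prod ν) {p | ¬ IsExecution f ε p.2 (run (A p.1) p.2)}
  have hNm : MeasurableSet N := measurableSet_toMeasurable _ _
  have hN : (μ.prod ν).real N ≤ η := by
    rw [measureReal_def, measure_toMeasurable]
    exact ENNReal.toReal_le_coe_of_le_coe hη
  -- There are finitely many draws, so `S` is a finite union of measurable rectangles.
  have hS : MeasurableSet S := by
    have : S = ⋃ x : Fin n → Fin D, ⋃ v ∈ B, {ω | CoinIs (A ω) x v} ×ˢ {x} := by
      ext ⟨ω, x⟩
      simp [S, and_comm]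
    rw [this]
    exact .iUnion fun x => .biUnion B.countable_toSet fun v _ =>
      (hA x v).prod (measurableSet_singleton x)
  have hle : ∀ ω, |ν.real (Prod.mk ω ⁻¹' S) - (B.card : ℝ) / D| ≤ ν.real (Prod.mk ω ⁻¹' N) := by
    intro ω
    refine (abs_localRandomness_sub_le (A ω) B).trans (measureReal_mono fun x hx => ?_)
    exact subset_toMeasurable _ _ fun hE : IsExecution f ε x (run (A ω) x) =>
      hx (hE.exists_pivot (grows_run _ _) hf)
  have hint : ∀ {T : Set (Ω × (Fin n → Fin D))}, MeasurableSet T →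
      Integrable (fun ω => ν.real (Prod.mk ω ⁻¹' T)) μ ∧
        ∫ ω, ν.real (Prod.mk ω ⁻¹' T) ∂μ = (μ.prod ν).real T := by
    intro T hT
    have hi := Measure.integrable_measure_prodMk_left (μ := μ) (ν := ν) hT (measure_ne_top _ _)
    refine ⟨hi, ?_⟩
    rw [measureReal_def, Measure.prod_apply hT]
    exact integral_toReal (measurable_measure_prodMk_left hT).aemeasurable
      (.of_forall fun _ => measure_lt_top _ _)
  calc |(μ.prod ν).real S - (B.card : ℝ) / D|
      = |∫ ω, (ν.real (Prod.mk ω ⁻¹' S) - (B.card : ℝ) / D) ∂μ| := by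
        rw [integral_sub (hint hS).1 (integrable_const _), (hint hS).2]
        simp
    _ ≤ ∫ ω, |ν.real (Prod.mk ω ⁻¹' S) - (B.card : ℝ) / D| ∂μ := abs_integral_le_integral_abs
    _ ≤ ∫ ω, ν.real (Prod.mk ω ⁻¹' N) ∂μ :=
        integral_mono ((hint hS).1.sub (integrable_const _)).abs (hint hNm).1 hle
    _ = (μ.prod ν).real N := (hint hNm).2
    _ ≤ η := hN

end ApproxCoin

theorem mainTheorem3 (n f D : ℕ) [NeZero D] (hf : 3 * f < n) (ε : ℝ) (hε : 0 < ε) (hε1 : ε ≤ 1)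
    {Ω : Type*} [MeasurableSpace Ω] (μ : Measure Ω) [IsProbabilityMeasure μ]
    (A : Ω → ApproxCoin.Adversary n D)
    (hA : ∀ (x : Fin n → Fin D) (v : ℤ),
      MeasurableSet {ω | ∃ i, ApproxCoin.FirstValue x (ApproxCoin.run (A ω) x) i v})
    (η : ℝ≥0)
    (hη : (μ.prod (ApproxCoin.localRandomness n D))
      {p | ¬ ApproxCoin.IsExecution f ε p.2 (ApproxCoin.run (A p.1) p.2)} ≤ η) :
    (∀ ω x, ApproxCoin.IsExecution f ε x (ApproxCoin.run (A ω) x) →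
      ApproxCoin.Termination x (ApproxCoin.run (A ω) x) ∧
      ApproxCoin.ApproxConsistency ε x (ApproxCoin.run (A ω) x) ∧
      ∃ i v, ApproxCoin.FirstValue x (ApproxCoin.run (A ω) x) i v ∧
        (ApproxCoin.Correct (ApproxCoin.run (A ω) x) i →
          ∀ v', ApproxCoin.Outputs x (ApproxCoin.run (A ω) x) i v' ↔ v' = v)) ∧
    ∀ B : Finset (Fin D),
      |(μ.prod (ApproxCoin.localRandomness n D)).real
          {p | ∃ v ∈ B, ∃ i, ApproxCoin.FirstValue p.2 (ApproxCoin.run (A p.1) p.2) i (v : ℕ)} -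
        (B.card : ℝ) / D| ≤ η := by
  refine ⟨fun ω x hE => ?_, fun B => ?_⟩
  · have hH := ApproxCoin.grows_run (A ω) x
    obtain ⟨t, i, w, hw⟩ := hE.exists_firstReturn (by omega) hH
    exact ⟨hE.termination hH, hE.approxConsistency hH hε.le (NeZero.pos D), i, _, ⟨t, w, hw, rfl⟩,
      fun hi v' => hE.outputs_iff hH hw hi v'⟩
  · exact ApproxCoin.abs_prod_real_sub_le hf μ A (fun x v => hA x (v : ℕ)) η hη B
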